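/- **Conventions.** For a $\mathbb{C}$-algebra $A$, let $\mathrm{Hilb}^{n}(\mathbb{C}^d)(A)$ be the set of ideals $I\subset A[x_1,\dots,x_d]$ such that $A[x_1,\dots,x_d]/I$ is a locally free $A$-module of finite rank $n$; a homomorphism $A\to B$ acts by extension of ideals. The Hilbert scheme $\mathrm{Hilb}^{n}(\mathbb{C}^d)$ is the $\mathbb{C}$-scheme whose functor of points on $\mathbb{C}$-algebras is this functor. Let $V_d\subset \mathrm{Hilb}^{d+1}(\mathbb{C}^d)$ be the symmetric affine open subscheme: it consists of all points $h$ whose ideal $I\subset\kappa(h)[x_1,\dots,x_d]$ has the property that $1,x_1,\dots,x_d$ is a $\kappa(h)$-basis of $\kappa(h)[x_1,\dots,x_d]/I$. Equivalently, it represents the subfunctor of those $I\subset A[x_1,\dots,x_d]$ for which $1,x_1,\dots,x_d$ is an $A$-basis of $A[x_1,\dots,x_d]/I$. **Proposition.** Let $d\ge 2$ and let $R_d$ be the polynomial ring over $\mathbb{C}$ in $d\left(\binom{d+1}{2}-1\right)$ variables. There is a homogeneous ideal $I_d\subset R_d$, generated by homogeneous polynomials of degree $2$, with $I_2=(0)$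 when $d=2$, such that the following holds. 1. The functor $A\mapsto\{I\subset A[x_1,\dots,x_d] : 1,x_1,\dots,x_d \text{ is an } A\text{-basis of } A[x_1,\dots,x_d]/I\}$ is an open subfunctor of $\mathrm{Hilb}^{d+1}(\mathbb{C}^d)$, and it is represented by the $\mathbb{C}$-scheme $\mathbb{C}^d\times_{\mathbb{C}}\mathrm{Spec}(R_d/I_d)$. 2. The set of points of the Hilbert scheme $\mathrm{Hilb}^{d+1}(\mathbb{C}^d)$ defining $V_d$ is open, and, as schemes over $\mathbb{C}$, $$V_d\;\cong\;\mathbb{C}^d\times_{\mathbb{C}}\mathrm{Spec}(R_d/I_d).$$ -/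

import Mathlib

open CategoryTheory CategoryTheory.Limits AlgebraicGeometry
open scoped TensorProduct

noncomputable section

namespace HilbertPoints

/-! ### Base change of ideals of polynomial rings -/

section BaseChange

theorem map_eq_map_map {A B P S T : Type*} [CommRing A] [CommRing B] [CommRing P] [CommRing S]
    [CommRing T] [Algebra A P] [Algebra A T] [Algebra B S] [Algebra B T]
    (f : P →+* S) (g : P →ₐ[A] T) (e : T ≃ₐ[B] S)
    (h : ∀ p, e (g p) = f p) (I : Ideal P) : I.map f = (I.map g).map (e : T →+* S) := by
  apply le_antisymm
  · refine Ideal.map_le_iff_le_comap.mpr fun p hp => ?_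
    rw [Ideal.mem_comap, ← h]
    exact Ideal.mem_map_of_mem (e : T →+* S) (Ideal.mem_map_of_mem g hp)
  · refine Ideal.map_le_iff_le_comap.mpr (Ideal.map_le_iff_le_comap.mpr fun p hp => ?_)
    have h1 := Ideal.mem_map_of_mem f hp
    rw [← h] at h1
    exact h1

variable {σ A B : Type*} [CommRing A] [CommRing B] [Algebra A B]

theorem algebraTensorAlgEquiv_one_tmul (p : MvPolynomial σ A) :
    MvPolynomial.algebraTensorAlgEquiv A B (1 ⊗ₜ[A] p) =
      MvPolynomial.map (algebraMap A B) p := by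
  simp

/-- For an ideal `I` of `A[x]`, the algebra `B[x] / I B[x]` is the base change of `A[x] / I`. -/
def quotientBaseChange (I : Ideal (MvPolynomial σ A)) :
    B ⊗[A] (MvPolynomial σ A ⧸ I) ≃ₐ[B]
      MvPolynomial σ B ⧸ I.map (MvPolynomial.map (algebraMap A B)) :=
  (Algebra.TensorProduct.tensorQuotientEquiv B (MvPolynomial σ A) B I).trans
    (Ideal.quotientEquivAlg _ _ (MvPolynomial.algebraTensorAlgEquiv A B)
      (map_eq_map_map _ _ _ algebraTensorAlgEquiv_one_tmul I))

theorem quotientBaseChange_one_tmul_mk (I : Ideal (MvPolynomial σ A)) (p : MvPolynomial σ A) :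
    quotientBaseChange (B := B) I (1 ⊗ₜ Ideal.Quotient.mk I p) =
      Ideal.Quotient.mk _ (MvPolynomial.map (algebraMap A B) p) := by
  rw [← algebraTensorAlgEquiv_one_tmul]
  rfl

end BaseChange

/-! ### The Hilbert functor of points of affine space -/

/-- The quotient of `A[x_1, …, x_d]` by the ideal `I` is a locally free `A`-module of finite
rank `n`, that is, `I` defines a closed subscheme of `𝔸^d` over `Spec A` which is finite and flat
of degree `n` over `Spec A`. If `A` is a field, this says that `I` has colength `n`. -/
structure HasColength {d : ℕ} {A : Type*} [CommRing A] (n : ℕ)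
    (I : Ideal (MvPolynomial (Fin d) A)) : Prop where
  finite : Module.Finite A (MvPolynomial (Fin d) A ⧸ I)
  projective : Module.Projective A (MvPolynomial (Fin d) A ⧸ I)
  rank : ∀ p : PrimeSpectrum A, Module.rankAtStalk (MvPolynomial (Fin d) A ⧸ I) p = n

/-- The family `1, x_1, …, x_d` in `A[x_1, …, x_d] / I`. -/
def oneAndCoords {d : ℕ} {A : Type*} [CommRing A] (I : Ideal (MvPolynomial (Fin d) A)) :
    Option (Fin d) → MvPolynomial (Fin d) A ⧸ I
  | none => 1
  | some i => Ideal.Quotient.mk I (MvPolynomial.X i)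

/-- `1, x_1, …, x_d` is an `A`-basis of `A[x_1, …, x_d] / I`. -/
structure IsSymmetric {d : ℕ} {A : Type*} [CommRing A]
    (I : Ideal (MvPolynomial (Fin d) A)) : Prop where
  linearIndependent : LinearIndependent A (oneAndCoords I)
  span_eq_top : Submodule.span A (Set.range (oneAndCoords I)) = ⊤

theorem HasColength.map {d n : ℕ} {A B : Type*} [CommRing A] [CommRing B] (f : A →+* B)
    {I : Ideal (MvPolynomial (Fin d) A)} (h : HasColength n I) :
    HasColength n (I.map (MvPolynomial.map f)) := by
  algebraize [f]
  have := h.finite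
  have := h.projective
  let e := (quotientBaseChange (B := B) I).toLinearEquiv
  refine ⟨Module.Finite.equiv e, Module.Projective.of_equiv e, fun p => ?_⟩
  have h1 := congrFun (Module.rankAtStalk_eq_of_equiv e) p
  rw [Module.rankAtStalk_baseChange, h.rank] at h1
  exact h1.symm

theorem IsSymmetric.map {d : ℕ} {A B : Type*} [CommRing A] [CommRing B] (f : A →+* B)
    {I : Ideal (MvPolynomial (Fin d) A)} (h : IsSymmetric I) :
    IsSymmetric (I.map (MvPolynomial.map f)) := by
  algebraize [f]
  let b := ((Module.Basis.mk h.linearIndependent h.span_eq_top.ge).baseChange B).map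
    (quotientBaseChange (B := B) I).toLinearEquiv
  have hb : ⇑b = oneAndCoords (I.map (MvPolynomial.map f)) := by
    funext i
    have h0 : b i = quotientBaseChange (B := B) I (1 ⊗ₜ oneAndCoords I i) := by simp [b]
    rw [h0]
    cases i with
    | none => exact map_one (quotientBaseChange (B := B) I)
    | some i =>
      refine (quotientBaseChange_one_tmul_mk I _).trans ?_
      rw [MvPolynomial.map_X]
      rfl
  exact ⟨hb ▸ b.linearIndependent, hb ▸ b.span_eq⟩

/-- The Hilbert functor of `n` points in affine `d`-space over `ℂ`: it sends a `ℂ`-algebra `A` to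
the set of ideals of `A[x_1, …, x_d]` whose quotient is locally free of rank `n` over `A`, and a
homomorphism `A → B` to the extension of ideals from `A[x]` to `B[x]`. -/
def hilbFunctor (d n : ℕ) : CommAlgCat.{0} ℂ ⥤ Type where
  obj A := {I : Ideal (MvPolynomial (Fin d) A) // HasColength n I}
  map {A B} f := ↾fun I => ⟨I.1.map (MvPolynomial.map f.hom.toRingHom), I.2.map _⟩
  map_id A := by
    ext I : 3
    refine Subtype.ext ?_
    refine Eq.trans (congrArg (fun g => Ideal.map g I.1) ?_) (Ideal.map_id I.1)
    exact MvPolynomial.ringHom_ext (by simp) (by simp)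
  map_comp {A B C} f g := by
    ext I : 3
    refine Subtype.ext ?_
    refine Eq.trans (congrArg (fun g => Ideal.map g I.1) ?_) (Ideal.map_map
      (MvPolynomial.map f.hom.toRingHom) (MvPolynomial.map g.hom.toRingHom)).symm
    exact MvPolynomial.ringHom_ext (by simp) (by simp)

/-- The subfunctor of the Hilbert functor of `d + 1` points in affine `d`-space consisting of the
ideals `I` such that `1, x_1, …, x_d` is a basis of the quotient by `I`. -/
def symFunctor (d : ℕ) : Subfunctor (hilbFunctor d (d + 1)) where
  obj _ := {I | IsSymmetric I.1}
  map _ _ hI := IsSymmetric.map _ hI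

/-- A subfunctor `G` of a functor `F` on `ℂ`-algebras is open if for each `x ∈ F(A)` there is an
open subset `U` of `Spec A` such that `Spec B → Spec A` factors through `U` if and only if `x`
is mapped into `G(B)`. -/
def IsOpenSubfunctor {F : CommAlgCat.{0} ℂ ⥤ Type} (G : Subfunctor F) : Prop :=
  ∀ (A : CommAlgCat.{0} ℂ) (x : F.obj A), ∃ U : TopologicalSpace.Opens (PrimeSpectrum A),
    ∀ (B : CommAlgCat.{0} ℂ) (f : A ⟶ B),
      F.map f x ∈ G.obj B ↔ Set.range (PrimeSpectrum.comap f.hom.toRingHom) ⊆ U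

/-- The polynomial ring over `ℂ` in `d (binom(d + 1, 2) - 1)` variables. -/
abbrev polyRing (d : ℕ) : Type := MvPolynomial (Fin (d * ((d + 1).choose 2 - 1))) ℂ

/-! ### Schemes over `ℂ` -/

/-- Schemes over `ℂ`. -/
abbrev SchC : Type 1 := Over (Spec (CommRingCat.of ℂ))

/-- The functor of points `A ↦ Hom_ℂ(Spec A, X)` of a scheme `X` over `ℂ`, on `ℂ`-algebras. -/
def functorOfPoints (X : SchC) : CommAlgCat.{0} ℂ ⥤ Type :=
  (algSpec (CommRingCat.of ℂ)).rightOp ⋙ yoneda.obj X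

/-- The affine scheme `Spec A` over `ℂ`. -/
def specC (A : Type) [CommRing A] [Algebra ℂ A] : SchC :=
  Over.mk (Spec.map (CommRingCat.ofHom (algebraMap ℂ A)))

/-- The affine space `ℂ^d`. -/
def affineSpaceC (d : ℕ) : SchC :=
  Over.mk (𝔸(Fin d; Spec (CommRingCat.of ℂ)) ↘ Spec (CommRingCat.of ℂ))

/-- The product `X ×_ℂ Y`. -/
def prodC (X Y : SchC) : SchC :=
  Over.mk (pullback.fst X.hom Y.hom ≫ X.hom)

/-- The open subscheme of `X` on the open set `U`. -/
def openC (X : SchC) (U : X.left.Opens) : SchC :=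
  Over.mk (U.ι ≫ X.hom)

/-- The residue field of `X` at `x` as a `ℂ`-algebra. -/
def residueAlg (X : SchC) (x : X.left) : CommAlgCat.{0} ℂ :=
  letI : Algebra ℂ (X.left.residueField x) :=
    (Spec.preimage (X.left.fromSpecResidueField x ≫ X.hom)).hom.toAlgebra
  CommAlgCat.of ℂ (X.left.residueField x)

/-- The canonical point `Spec κ(x) → X`. -/
def residuePoint (X : SchC) (x : X.left) : (functorOfPoints X).obj (residueAlg X x) :=
  Over.homMk (U := (algSpec (CommRingCat.of ℂ)).obj (.op (residueAlg X x)))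
    (X.left.fromSpecResidueField x)
    (Spec.map_preimage (X.left.fromSpecResidueField x ≫ X.hom)).symm

/-- A scheme `H` over `ℂ` is the Hilbert scheme of `n` points in `ℂ^d` if it is equipped with an
isomorphism of its functor of points with the Hilbert functor. -/
abbrev HilbertSchemeStructure (d n : ℕ) (H : SchC) : Type 1 :=
  functorOfPoints H ≅ hilbFunctor d n

/-- The locus in the Hilbert scheme `H` of `d + 1` points in `ℂ^d` of those points `h` whose
corresponding ideal `I` of `κ(h)[x_1, …, x_d]` has the property that `1, x_1, …, x_d` is
a basis of the quotient by `I`. -/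
def symLocus {d : ℕ} {H : SchC} (e : HilbertSchemeStructure d (d + 1) H) : Set H.left :=
  {h | e.hom.app (residueAlg H h) (residuePoint H h) ∈ (symFunctor d).obj (residueAlg H h)}

end HilbertPoints

end

/-!
An ideal `I` of `A[x_1, …, x_d]` for which `1, x_1, …, x_d` is a basis of the quotient is the same
as a multiplication table for the products `x_i x_j` which makes the free module on `1, x_i` into
a commutative associative algebra. As `2` is invertible, there is a unique translation of the
coordinates after which no `x_k ^ 2` involves `x_k`: this splits off the factor `ℂ^d` and leaves
`d (binom(d + 1, 2) - 1)` linear coefficients `c i j k`, besides the constant coefficients.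

The coefficient of `x_m` in an associator is a quadric in the `c i j k` plus a difference of
constant coefficients. Since `d ≥ 2`, these equations determine the constant coefficients, and
eliminating them leaves the quadrics that generate `I_d`. Then all associators are constant, and
the cocycle identity for associators forces them to vanish, so the constant coefficients of
associators give no further condition. Hence `ℂ^d × Spec (R_d / I_d)` carries the universal
symmetric ideal.

The symmetric ideals form an open subfunctor, since the condition on `I` is that the cokernel of
`1, x_1, …, x_d` vanishes, which holds away from its support. The open subscheme on the
corresponding points of the Hilbert scheme represents this subfunctor, so by the Yoneda lemma for
functors of points on `ℂ`-algebras it is isomorphic to `ℂ^d × Spec (R_d / I_d)`.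
-/

noncomputable section

namespace HilbertPoints

/-! ### Associators in algebras with basis `1, x_i` -/

section Associator

variable {κ ι A M : Type*} [CommRing A]

theorem associator_mem_of_basis [NonUnitalNonAssocRing M] [Module A M] [SMulCommClass A M M]
    [IsScalarTower A M M] (b : Module.Basis κ A M) (N : Submodule A M)
    (h : ∀ i j k, associator (b i) (b j) (b k) ∈ N) (x y z : M) : associator x y z ∈ N := by
  let μ : M →ₗ[A] M →ₗ[A] M := LinearMap.mul A M
  let L : M →ₗ[A] M →ₗ[A] M →ₗ[A] M ⧸ N :=
    (μ.compr₂ μ - (LinearMap.llcomp A M M M).compl₁₂ μ μ).compr₂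
      (LinearMap.llcomp A M M (M ⧸ N) N.mkQ)
  have mk_associator (x y z : M) : L x y z = N.mkQ (associator x y z) := rfl
  have L_eq_zero : L = 0 := b.ext fun i => b.ext fun j => b.ext fun k => by
    rw [mk_associator, Submodule.mkQ_apply, (Submodule.Quotient.mk_eq_zero N).mpr (h i j k)]
    rfl
  rw [← Submodule.Quotient.mk_eq_zero, ← Submodule.mkQ_apply, ← mk_associator, L_eq_zero]
  rfl

variable [NonAssocRing M] [Module A M] [SMulCommClass A M M] [IsScalarTower A M M]

theorem associator_eq_zero_of_mem_span_one [Nontrivial ι] (b : Module.Basis (Option ι) A M)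
    (hb : b none = 1) (h : ∀ x y z : M, associator x y z ∈ Submodule.span A {(1 : M)})
    (x y z : M) : associator x y z = 0 := by
  refine (Submodule.mem_bot A).mp (associator_mem_of_basis b ⊥ (fun o o' o'' => ?_) x y z)
  rw [Submodule.mem_bot]
  rcases o'' with _ | k
  · rw [hb, associator_apply, mul_one, mul_one, sub_self]
  obtain ⟨l, hl⟩ := exists_ne k
  obtain ⟨s, hs⟩ := Submodule.mem_span_singleton.mp (h (b o) (b o') (b (some k)))
  obtain ⟨s', hs'⟩ := Submodule.mem_span_singleton.mp (h (b (some l)) (b o) (b o'))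
  have coord_associator (x y z : M) : b.repr (associator x y z) (some l) = 0 := by
    obtain ⟨r, hr⟩ := Submodule.mem_span_singleton.mp (h x y z)
    simp [← hr, ← hb]
  -- In the cocycle identity for `x_l, u, v, x_k` with `l ≠ k`, the only term with a nonzero
  -- coefficient of `x_l` is `x_l * (u, v, x_k)`.
  have cocycle := congrArg (fun x => b.repr x (some l))
    (associator_cocycle (b (some l)) (b o) (b o') (b (some k)))
  have : s = 0 := by simpa [← hs, ← hs', coord_associator, hl.symm] using cocycle
  rw [← hs, this, zero_smul]

end Associator

section TranslateBasis

variable {ι A M : Type*} [CommRing A] [AddCommGroup M] [Module A M]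

/-- The basis `b_none, b_i + t_i b_none`. For the basis `1, x_i` of an algebra, this is the
translation of the coordinates `x_i` by `t_i`. -/
def translateBasis (b : Module.Basis (Option ι) A M) (t : ι → A) : Module.Basis (Option ι) A M :=
  b.map (LinearEquiv.transvection (f := b.constr A fun o => o.elim 0 t) (v := b none) (by simp))

theorem translateBasis_none (b : Module.Basis (Option ι) A M) (t : ι → A) :
    translateBasis b t none = b none := by
  simp [translateBasis, LinearMap.transvection.apply]

theorem translateBasis_some (b : Module.Basis (Option ι) A M) (t : ι → A) (i : ι) :
    translateBasis b t (some i) = b (some i) + t i • b none := by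
  simp [translateBasis, LinearMap.transvection.apply]

end TranslateBasis

section AssocDefect

variable {ι A B M : Type*} [Fintype ι] [CommRing A] [CommRing B]

/-- For an algebra with basis `1, x_i` and multiplication `x_i x_j = … + ∑ k, c i j k x_k`, the
part of the coefficient of `x_m` in `x_i (x_j x_k) - (x_i x_j) x_k` which does not involve the
constant coefficients of the products `x_i x_j`. -/
def assocDefect (c : ι → ι → ι → A) (i j k m : ι) : A :=
  ∑ l, c j k l * c i l m - ∑ l, c i j l * c k l m

theorem assocDefect_map (f : A →+* B) (c : ι → ι → ι → A) (i j k m : ι) :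
    assocDefect (fun i j k => f (c i j k)) i j k m = f (assocDefect c i j k m) := by
  simp [assocDefect]

theorem assocDefect_swap {c : ι → ι → ι → A} (hc : ∀ i j k, c i j k = c j i k)
    (i j k m : ι) : assocDefect c i j k m = - assocDefect c k j i m := by
  simp only [assocDefect, neg_sub, hc j k, hc i j]

theorem repr_associator [DecidableEq ι] [NonAssocCommRing M] [Module A M] [SMulCommClass A M M]
    [IsScalarTower A M M] (b : Module.Basis (Option ι) A M) (hb : b none = 1) (i j k m : ι) :
    b.repr (associator (b (some i)) (b (some j)) (b (some k))) (some m) =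
      (if k = m then b.repr (b (some i) * b (some j)) none else 0) -
        (if i = m then b.repr (b (some j) * b (some k)) none else 0) -
        assocDefect (fun i j k => b.repr (b (some i) * b (some j)) (some k)) i j k m := by
  have repr_mul (i : ι) (x : M) : b.repr (b (some i) * x) (some m) =
      (if i = m then b.repr x none else 0) +
        ∑ l, b.repr x (some l) * b.repr (b (some i) * b (some l)) (some m) := by
    conv_lhs => rw [← b.sum_repr x, Fintype.sum_option, hb, mul_add, Finset.mul_sum]
    simp [mul_smul_comm, Finsupp.single_apply]
  rw [associator_apply, mul_comm _ (b (some k)), map_sub, Finsupp.sub_apply, repr_mul, repr_mul,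
    assocDefect]
  ring

end AssocDefect

/-! ### Multiplication tables -/

section MultTable

/-- A commutative multiplication table `x_i x_j = const i j + ∑ k, coeff i j k x_k` on the free
module with basis `1, x_i`. The last field says that the coefficient of each `x_m` in the associator
of `x_i, x_j, x_k` vanishes; nothing is asked of the constant coefficients of associators. -/
structure MultTable (ι A : Type*) [Fintype ι] [DecidableEq ι] [CommRing A] where
  const : ι → ι → A
  coeff : ι → ι → ι → A
  const_comm : ∀ i j, const i j = const j i
  coeff_comm : ∀ i j k, coeff i j k = coeff j i k
  assocDefect_coeff : ∀ i j k m, assocDefect coeff i j k m =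
    (if k = m then const i j else 0) - (if i = m then const j k else 0)

variable {ι A B : Type*} [Fintype ι] [CommRing A] [CommRing B]

/-- The quadrics in linear coefficients `c` whose vanishing means that `c` can be completed to a
commutative algebra with basis `1, x_i`. They arise from the coefficients of associators by
eliminating the constant coefficients of the products `x_i x_j`. -/
def quadrics (c : ι → ι → ι → A) : Set A :=
  {q | ∃ i j k m, m ≠ i ∧ m ≠ k ∧ assocDefect c i j k m = q} ∪
  {q | ∃ i j k i', i ≠ k ∧ i' ≠ j ∧ assocDefect c i j k i - assocDefect c i' k j i' = q}

theorem quadrics_map (f : A →+* B) (c : ι → ι → ι → A) :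
    quadrics (fun i j k => f (c i j k)) = f '' quadrics c := by
  ext q
  simp only [quadrics, assocDefect_map, ← map_sub, Set.image_union]
  refine or_congr ⟨?_, ?_⟩ ⟨?_, ?_⟩
  · rintro ⟨i, j, k, m, hi, hk, rfl⟩
    exact ⟨_, ⟨i, j, k, m, hi, hk, rfl⟩, rfl⟩
  · rintro ⟨_, ⟨i, j, k, m, hi, hk, rfl⟩, rfl⟩
    exact ⟨i, j, k, m, hi, hk, rfl⟩
  · rintro ⟨i, j, k, i', hi, hi', rfl⟩
    exact ⟨_, ⟨i, j, k, i', hi, hi', rfl⟩, rfl⟩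
  · rintro ⟨_, ⟨i, j, k, i', hi, hi', rfl⟩, rfl⟩
    exact ⟨i, j, k, i', hi, hi', rfl⟩

namespace MultTable

variable [DecidableEq ι]

/-- The base change of a multiplication table. -/
@[simps]
def map (f : A →+* B) (T : MultTable ι A) : MultTable ι B where
  const i j := f (T.const i j)
  coeff i j k := f (T.coeff i j k)
  const_comm i j := by rw [T.const_comm]
  coeff_comm i j k := by rw [T.coeff_comm]
  assocDefect_coeff i j k m := by
    rw [assocDefect_map, T.assocDefect_coeff, map_sub, apply_ite f, apply_ite f, map_zero]

/-- A table is normalized if no `x_k ^ 2` involves `x_k`. If `2` is invertible, a unique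
translation of the `x_k` achieves this. -/
def IsNormalized (T : MultTable ι A) : Prop := ∀ k, T.coeff k k k = 0

theorem IsNormalized.map {T : MultTable ι A} (hT : T.IsNormalized) (f : A →+* B) :
    (T.map f).IsNormalized := fun k => by
  rw [map_coeff, hT k, map_zero]

theorem const_eq_neg_assocDefect (T : MultTable ι A) (j : ι) {k l : ι} (h : l ≠ k) :
    T.const j k = - assocDefect T.coeff l j k l := by
  simp [T.assocDefect_coeff, h.symm]

theorem ext_of_coeff [Nontrivial ι] {T T' : MultTable ι A} (h : T.coeff = T'.coeff) : T = T' := by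
  have : T.const = T'.const := by
    ext j k
    obtain ⟨l, hl⟩ := exists_ne k
    rw [T.const_eq_neg_assocDefect j hl, T'.const_eq_neg_assocDefect j hl, h]
  cases T
  congr

theorem eq_zero_of_mem_quadrics (T : MultTable ι A) {q : A} (hq : q ∈ quadrics T.coeff) :
    q = 0 := by
  rcases hq with ⟨i, j, k, m, hi, hk, rfl⟩ | ⟨i, j, k, i', hi, hi', rfl⟩
  · simp [T.assocDefect_coeff, hi.symm, hk.symm]
  · simp [T.assocDefect_coeff, hi.symm, hi'.symm, T.const_comm j k]

/-- The multiplication table with given linear coefficients. With at least two indices, the constant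
coefficient of `x_j x_k` is forced: it cancels the coefficient of `x_l` in the associator of
`x_l, x_j, x_k` for any `l ≠ k`. -/
def ofCoeff [Nontrivial ι] (c : ι → ι → ι → A) (hc : ∀ i j k, c i j k = c j i k)
    (h : ∀ q ∈ quadrics c, q = 0) : MultTable ι A :=
  let other (k : ι) : ι := (exists_ne k).choose
  have other_ne (k : ι) : other k ≠ k := (exists_ne k).choose_spec
  have diag {i j k i' : ι} (hi : i ≠ k) (hi' : i' ≠ j) :
      assocDefect c i j k i = assocDefect c i' k j i' :=
    sub_eq_zero.mp (h _ (Or.inr ⟨i, j, k, i', hi, hi', rfl⟩))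
  have diag_other {i j k : ι} (hi : i ≠ k) :
      assocDefect c i j k i = assocDefect c (other k) j k (other k) :=
    (diag hi (other_ne j)).trans (diag (other_ne k) (other_ne j)).symm
  have const_comm (j k : ι) :
      -assocDefect c (other k) j k (other k) = -assocDefect c (other j) k j (other j) :=
    congrArg Neg.neg (diag (other_ne k) (other_ne j))
  { const := fun j k => -assocDefect c (other k) j k (other k)
    coeff := c
    const_comm := const_comm
    coeff_comm := hc
    assocDefect_coeff := fun i j k m => by
      by_cases hik : i = k
      · subst hik
        rw [const_comm j i, sub_self, assocDefect]
        simp only [hc i j, sub_self]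
      by_cases him : i = m
      · subst him
        rw [diag_other hik, if_pos rfl, if_neg (Ne.symm hik), zero_sub, neg_neg]
      by_cases hkm : k = m
      · subst hkm
        rw [assocDefect_swap hc, diag_other (Ne.symm hik), if_pos rfl, if_neg hik, sub_zero,
          const_comm]
      · rw [h _ (Or.inl ⟨i, j, k, m, Ne.symm him, Ne.symm hkm, rfl⟩), if_neg hkm, if_neg him,
          sub_zero] }

end MultTable

end MultTable

namespace MultTable

section Alg

variable {ι A : Type*} [Fintype ι] [DecidableEq ι] [CommRing A] (T : MultTable ι A)

/-- The algebra with basis `1, x_i` and multiplication given by the table `T`. -/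
def Alg (_ : MultTable ι A) : Type _ := Option ι →₀ A

instance : AddCommGroup T.Alg := inferInstanceAs (AddCommGroup (Option ι →₀ A))

instance : Module A T.Alg := inferInstanceAs (Module A (Option ι →₀ A))

/-- The basis `1, x_i` of the algebra of a table. -/
def basis : Module.Basis (Option ι) A T.Alg := Finsupp.basisSingleOne

/-- The product of two elements of the basis `1, x_i`. -/
def basisMul : Option ι → Option ι → T.Alg
  | none, o => T.basis o
  | some i, none => T.basis (some i)
  | some i, some j => T.const i j • T.basis none + ∑ k, T.coeff i j k • T.basis (some k)

/-- The multiplication of the algebra of a table. -/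
def mulLinear : T.Alg →ₗ[A] T.Alg →ₗ[A] T.Alg :=
  T.basis.constr A fun o => T.basis.constr A fun o' => T.basisMul o o'

theorem mulLinear_basis (o o' : Option ι) :
    T.mulLinear (T.basis o) (T.basis o') = T.basisMul o o' := by
  rw [mulLinear, Module.Basis.constr_basis, Module.Basis.constr_basis]

theorem mulLinear_flip : T.mulLinear.flip = T.mulLinear := by
  refine T.basis.ext fun o => T.basis.ext fun o' => ?_
  rw [LinearMap.flip_apply, mulLinear_basis, mulLinear_basis]
  rcases o with _ | i <;> rcases o' with _ | j <;> try rfl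
  simp only [basisMul, T.const_comm i j, T.coeff_comm i j]

theorem mulLinear_basis_none : T.mulLinear (T.basis none) = LinearMap.id :=
  T.basis.ext fun o => T.mulLinear_basis none o

instance : NonAssocCommRing T.Alg where
  mul x y := T.mulLinear x y
  one := T.basis none
  left_distrib x := map_add (T.mulLinear x)
  right_distrib := LinearMap.map_add₂ T.mulLinear
  zero_mul := LinearMap.map_zero₂ T.mulLinear
  mul_zero x := map_zero (T.mulLinear x)
  one_mul := LinearMap.congr_fun T.mulLinear_basis_none
  mul_one x := (LinearMap.congr_fun (LinearMap.congr_fun T.mulLinear_flip _) x).trans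
    (LinearMap.congr_fun T.mulLinear_basis_none x)
  mul_comm x y := LinearMap.congr_fun (LinearMap.congr_fun T.mulLinear_flip y) x

instance : SMulCommClass A T.Alg T.Alg :=
  ⟨fun r x y => ((T.mulLinear x).map_smul r y).symm⟩

instance : IsScalarTower A T.Alg T.Alg :=
  ⟨fun r x y => LinearMap.map_smul₂ T.mulLinear r x y⟩

theorem basis_none : T.basis none = 1 := rfl

theorem basis_mul_basis (i j : ι) : T.basis (some i) * T.basis (some j) =
    T.const i j • T.basis none + ∑ k, T.coeff i j k • T.basis (some k) :=
  T.mulLinear_basis (some i) (some j)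

theorem repr_associator_eq_zero (i j k m : ι) :
    T.basis.repr (associator (T.basis (some i)) (T.basis (some j)) (T.basis (some k)))
      (some m) = 0 := by
  have repr_none (i j : ι) :
      T.basis.repr (T.basis (some i) * T.basis (some j)) none = T.const i j := by
    simp [basis_mul_basis]
  have repr_some (i j k : ι) :
      T.basis.repr (T.basis (some i) * T.basis (some j)) (some k) = T.coeff i j k := by
    simp [basis_mul_basis, Finsupp.single_apply]
  rw [HilbertPoints.repr_associator T.basis T.basis_none]
  simp only [repr_none, repr_some, T.assocDefect_coeff, sub_self]

theorem associator_basis_mem_span_one (o o' o'' : Option ι) :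
    associator (T.basis o) (T.basis o') (T.basis o'') ∈ Submodule.span A {(1 : T.Alg)} := by
  rcases o with _ | i
  · simp [associator_apply, basis_none]
  rcases o' with _ | j
  · simp [associator_apply, basis_none]
  rcases o'' with _ | k
  · simp [associator_apply, basis_none]
  rw [← T.basis.sum_repr (associator _ _ _), Fintype.sum_option, basis_none]
  simp only [repr_associator_eq_zero, zero_smul, Finset.sum_const_zero, add_zero]
  exact Submodule.smul_mem _ _ (Submodule.mem_span_singleton_self 1)

variable [Nontrivial ι]

instance : CommRing T.Alg where
  mul_assoc x y z := sub_eq_zero.mp <| associator_eq_zero_of_mem_span_one T.basis T.basis_none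
    (associator_mem_of_basis T.basis _ T.associator_basis_mem_span_one) x y z
  mul_comm := mul_comm

instance : Algebra A T.Alg := Algebra.ofModule smul_mul_assoc fun r x y => mul_smul_comm r x y

end Alg

section IsTableOf

variable {ι A Q : Type*} [Fintype ι] [DecidableEq ι] [CommRing A] [CommRing Q] [Algebra A Q]

/-- The elements `y_i` of an algebra multiply according to the table `T`. -/
def IsTableOf (T : MultTable ι A) (y : ι → Q) : Prop :=
  ∀ i j, y i * y j = algebraMap A Q (T.const i j) + ∑ k, T.coeff i j k • y k

theorem isTableOf_basis [Nontrivial ι] (T : MultTable ι A) :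
    T.IsTableOf fun i => T.basis (some i) := fun i j => by
  rw [basis_mul_basis, basis_none, Algebra.algebraMap_eq_smul_one]

theorem exists_isTableOf (b : Module.Basis (Option ι) A Q) (hb : b none = 1) :
    ∃ T : MultTable ι A, T.IsTableOf fun i => b (some i) := by
  refine ⟨{
    const i j := b.repr (b (some i) * b (some j)) none
    coeff i j k := b.repr (b (some i) * b (some j)) (some k)
    const_comm i j := by rw [mul_comm]
    coeff_comm i j k := by rw [mul_comm]
    assocDefect_coeff i j k m := ?_ }, fun i j => ?_⟩
  · have := repr_associator b hb i j k m
    rw [associator_apply, mul_assoc, sub_self, map_zero, Finsupp.zero_apply] at this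
    exact (sub_eq_zero.mp this.symm).symm
  · conv_lhs => rw [← b.sum_repr (b (some i) * b (some j)), Fintype.sum_option, hb,
      ← Algebra.algebraMap_eq_smul_one]

theorem IsTableOf.mul_eq {T : MultTable ι A} {x : ι → Q} {t : ι → A}
    (h : T.IsTableOf fun i => x i - algebraMap A Q (t i)) (i j : ι) :
    x i * x j = t j • x i + t i • x j + (T.const i j - t i * t j) • 1 +
      ∑ k, T.coeff i j k • (x k - t k • 1) := by
  have := h i j
  simp only [Algebra.smul_def, map_sub, map_mul, mul_one] at this ⊢
  linear_combination this

theorem IsTableOf.repr_mul {T : MultTable ι A} {b : Module.Basis (Option ι) A Q}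
    (hb : b none = 1) {t : ι → A} (h : T.IsTableOf fun i => b (some i) - algebraMap A Q (t i))
    (i j k : ι) : b.repr (b (some i) * b (some j)) (some k) =
      T.coeff i j k + (if j = k then t i else 0) + (if i = k then t j else 0) := by
  rw [h.mul_eq, ← hb]
  simp [Finsupp.single_apply, add_assoc, add_comm, add_left_comm]

theorem existsUnique_isNormalized_isTableOf [Nontrivial ι] (h2 : IsUnit (2 : A))
    (b : Module.Basis (Option ι) A Q) (hb : b none = 1) :
    ∃! p : (ι → A) × MultTable ι A,
      p.2.IsNormalized ∧ p.2.IsTableOf fun i => b (some i) - algebraMap A Q (p.1 i) := by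
  -- The coefficient of `x_k` in `x_k ^ 2` is that of the table plus `2 t_k`.
  let s (k : ι) : A := b.repr (b (some k) * b (some k)) (some k)
  have repr_sq {t : ι → A} {T : MultTable ι A}
      (h : T.IsTableOf fun i => b (some i) - algebraMap A Q (t i)) (k : ι) :
      s k = T.coeff k k k + 2 * t k :=
    (h.repr_mul hb k k k).trans (by rw [if_pos rfl]; ring)
  have exists_half (k : ι) : ∃ a, 2 * a = s k := (h2.dvd : 2 ∣ s k).imp fun _ => Eq.symm
  choose t ht using exists_half
  have translate_some (i : ι) :
      translateBasis b (-t) (some i) = b (some i) - algebraMap A Q (t i) := by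
    rw [translateBasis_some, hb, Pi.neg_apply, ← Algebra.algebraMap_eq_smul_one, map_neg,
      sub_eq_add_neg]
  obtain ⟨T, hT⟩ := exists_isTableOf (translateBasis b (-t)) ((translateBasis_none b _).trans hb)
  simp only [translate_some] at hT
  refine ⟨(t, T), ⟨fun k => ?_, hT⟩, ?_⟩
  · exact add_eq_right.mp ((repr_sq hT k).symm.trans (ht k).symm)
  · rintro ⟨t', T'⟩ ⟨hn, hT'⟩
    have : t' = t := funext fun k => h2.mul_left_cancel <| by
      rw [ht, repr_sq hT', hn k, zero_add]
    subst this
    refine Prod.ext rfl (ext_of_coeff ?_)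
    funext i j k
    exact add_right_cancel (add_right_cancel
      ((hT'.repr_mul hb i j k).symm.trans (hT.repr_mul hb i j k)))

end IsTableOf

end MultTable

/-! ### Symmetric ideals and multiplication tables -/

section Ideals

open MvPolynomial

theorem submodule_eq_top_of_adjoin_eq_top {A Q : Type*} [CommSemiring A] [Semiring Q] [Algebra A Q]
    {s : Set Q} (hs : Algebra.adjoin A s = ⊤) {N : Submodule A Q} (one_mem : 1 ∈ N)
    (mul_mem : ∀ x ∈ N, ∀ y ∈ s, x * y ∈ N) : N = ⊤ := by
  rw [eq_top_iff, ← Algebra.top_toSubmodule, ← hs, Algebra.adjoin_eq_span, Submodule.span_le]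
  intro x hx
  induction hx using Submonoid.closure_induction_right with
  | one => exact one_mem
  | mul_right x _ y hy hx => exact mul_mem x hx y hy

section Symmetric

variable {d : ℕ} {A : Type*} [CommRing A] {I : Ideal (MvPolynomial (Fin d) A)}

theorem adjoin_range_mk_X {σ : Type*} (I : Ideal (MvPolynomial σ A)) :
    Algebra.adjoin A (Set.range fun i => Ideal.Quotient.mk I (X i)) = ⊤ := by
  have := (Ideal.Quotient.mkₐ A I).map_adjoin (Set.range X)
  rw [adjoin_range_X, Algebra.map_top, (AlgHom.range_eq_top _).mpr
    (Ideal.Quotient.mkₐ_surjective A I), ← Set.range_comp] at this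
  exact this.symm

theorem span_oneAndCoords_eq_top
    (h : ∀ i j, Ideal.Quotient.mk I (X i) * Ideal.Quotient.mk I (X j) ∈
      Submodule.span A (Set.range (oneAndCoords I))) :
    Submodule.span A (Set.range (oneAndCoords I)) = ⊤ := by
  refine submodule_eq_top_of_adjoin_eq_top (adjoin_range_mk_X I) (Submodule.subset_span ⟨none, rfl⟩)
    fun x hx => ?_
  rintro _ ⟨j, rfl⟩
  induction hx using Submodule.span_induction with
  | mem x hx =>
    obtain ⟨_ | i, rfl⟩ := hx
    · exact (one_mul (Ideal.Quotient.mk I (X j))).symm ▸ Submodule.subset_span ⟨some j, rfl⟩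
    · exact h i j
  | zero => rw [zero_mul]; exact zero_mem _
  | add x y _ _ hx hy => rw [add_mul]; exact add_mem hx hy
  | smul a x _ hx => rw [smul_mul_assoc]; exact Submodule.smul_mem _ a hx

namespace IsSymmetric

/-- The basis `1, x_1, …, x_d` of the quotient by a symmetric ideal. -/
def basis (h : IsSymmetric I) : Module.Basis (Option (Fin d)) A (MvPolynomial (Fin d) A ⧸ I) :=
  Module.Basis.mk h.linearIndependent h.span_eq_top.ge

theorem basis_none (h : IsSymmetric I) : h.basis none = 1 :=
  Module.Basis.mk_apply _ _ none

theorem basis_some (h : IsSymmetric I) (i : Fin d) :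
    h.basis (some i) = Ideal.Quotient.mk I (X i) :=
  Module.Basis.mk_apply _ _ (some i)

theorem eq_of_le {J : Ideal (MvPolynomial (Fin d) A)} (hI : IsSymmetric I)
    (hJ : Submodule.span A (Set.range (oneAndCoords J)) = ⊤) (h : J ≤ I) : J = I := by
  let φ : (MvPolynomial (Fin d) A ⧸ J) →ₗ[A] (MvPolynomial (Fin d) A ⧸ I) :=
    (Ideal.Quotient.factorₐ A h).toLinearMap
  have φ_comp : φ ∘ oneAndCoords J = oneAndCoords I := by
    funext o
    rcases o with _ | i
    · exact map_one (Ideal.Quotient.factorₐ A h)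
    · exact Ideal.Quotient.factor_mk h (X i)
  have disjoint_ker : Disjoint ⊤ (LinearMap.ker φ) :=
    hJ ▸ Submodule.range_ker_disjoint (φ_comp ▸ hI.linearIndependent)
  have φ_injective : Function.Injective φ := LinearMap.ker_eq_bot.mp (top_disjoint.mp disjoint_ker)
  refine le_antisymm h fun p hp => ?_
  rw [← Ideal.Quotient.eq_zero_iff_mem] at hp ⊢
  exact φ_injective (hp.trans (map_zero φ).symm)

theorem hasColength (h : IsSymmetric I) : HasColength (d + 1) I := by
  have := Module.Free.of_basis h.basis
  have := Module.Finite.of_basis h.basis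
  refine ⟨this, inferInstance, fun p => ?_⟩
  have := p.nontrivial
  rw [Module.rankAtStalk_eq_finrank_of_free, Module.finrank_eq_card_basis h.basis]
  simp

end IsSymmetric

end Symmetric

namespace MultTable

variable {ι A B : Type*} [Fintype ι] [DecidableEq ι] [CommRing A] [CommRing B]

/-- The ideal of the polynomial ring generated by the relations which say that the coordinates
`x_i - t_i` multiply according to the table `T`. -/
def ideal (T : MultTable ι A) (t : ι → A) : Ideal (MvPolynomial ι A) :=
  Ideal.span <| Set.range fun p : ι × ι => (X p.1 - C (t p.1)) * (X p.2 - C (t p.2)) -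
    (C (T.const p.1 p.2) + ∑ k, C (T.coeff p.1 p.2 k) * (X k - C (t k)))

theorem ideal_map (T : MultTable ι A) (t : ι → A) (f : A →+* B) :
    (T.ideal t).map (MvPolynomial.map f) = (T.map f).ideal fun i => f (t i) := by
  rw [ideal, ideal, Ideal.map_span, ← Set.range_comp]
  congr 2
  funext p
  simp

theorem ideal_le_ker_iff {Q : Type*} [CommRing Q] [Algebra A Q] {T : MultTable ι A} {t : ι → A}
    {φ : MvPolynomial ι A →ₐ[A] Q} : T.ideal t ≤ RingHom.ker φ ↔
      T.IsTableOf fun i => φ (X i) - algebraMap A Q (t i) := by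
  rw [ideal, Ideal.span_le, Set.range_subset_iff, Prod.forall]
  refine forall₂_congr fun i j => ?_
  simp [RingHom.mem_ker, ← algebraMap_eq, Algebra.smul_def, sub_eq_zero]

theorem ideal_le_iff {T : MultTable ι A} {t : ι → A} {I : Ideal (MvPolynomial ι A)} :
    T.ideal t ≤ I ↔ T.IsTableOf fun i =>
      Ideal.Quotient.mk I (X i) - algebraMap A (MvPolynomial ι A ⧸ I) (t i) := by
  conv_lhs => rw [← Ideal.Quotient.mkₐ_ker A I]
  exact ideal_le_ker_iff

theorem span_oneAndCoords_ideal {d : ℕ} (T : MultTable (Fin d) A) (t : Fin d → A) :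
    Submodule.span A (Set.range (oneAndCoords (T.ideal t))) = ⊤ := by
  refine span_oneAndCoords_eq_top fun i j => ?_
  rw [(ideal_le_iff.mp le_rfl).mul_eq]
  set N := Submodule.span A (Set.range (oneAndCoords (T.ideal t)))
  have one_mem : 1 ∈ N := Submodule.subset_span ⟨none, rfl⟩
  have X_mem (i : Fin d) : Ideal.Quotient.mk _ (X i) ∈ N := Submodule.subset_span ⟨some i, rfl⟩
  exact N.add_mem (N.add_mem (N.add_mem (N.smul_mem _ (X_mem i)) (N.smul_mem _ (X_mem j)))
    (N.smul_mem _ one_mem)) (N.sum_mem fun k _ =>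
      N.smul_mem _ (N.sub_mem (X_mem k) (N.smul_mem _ one_mem)))

theorem isSymmetric_ideal {d : ℕ} [Nontrivial (Fin d)] (T : MultTable (Fin d) A) (t : Fin d → A) :
    IsSymmetric (T.ideal t) := by
  refine ⟨?_, T.span_oneAndCoords_ideal t⟩
  let φ : MvPolynomial (Fin d) A →ₐ[A] T.Alg := aeval fun i => translateBasis T.basis t (some i)
  have ideal_le : T.ideal t ≤ RingHom.ker φ := ideal_le_ker_iff.mpr <| by
    simpa [φ, translateBasis_some, basis_none, Algebra.algebraMap_eq_smul_one]
      using T.isTableOf_basis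
  let ψ : (MvPolynomial (Fin d) A ⧸ T.ideal t) →ₐ[A] T.Alg :=
    Ideal.Quotient.liftₐ _ φ fun _ hp => ideal_le hp
  refine LinearIndependent.of_comp ψ.toLinearMap ?_
  have ψ_comp : ψ ∘ oneAndCoords (T.ideal t) = translateBasis T.basis t := by
    funext o
    rcases o with _ | i
    · rw [translateBasis_none]
      exact map_one ψ
    · exact aeval_X _ i
  exact ψ_comp ▸ (translateBasis T.basis t).linearIndependent

end MultTable

theorem IsSymmetric.existsUnique_ideal_eq {d : ℕ} [Nontrivial (Fin d)] {A : Type*} [CommRing A]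
    {I : Ideal (MvPolynomial (Fin d) A)} (hI : IsSymmetric I) (h2 : IsUnit (2 : A)) :
    ∃! p : (Fin d → A) × MultTable (Fin d) A, p.2.IsNormalized ∧ p.2.ideal p.1 = I := by
  have ideal_eq_iff (p : (Fin d → A) × MultTable (Fin d) A) : p.2.ideal p.1 = I ↔
      p.2.IsTableOf fun i => hI.basis (some i) - algebraMap A _ (p.1 i) := by
    simp only [hI.basis_some, ← MultTable.ideal_le_iff]
    exact ⟨le_of_eq, hI.eq_of_le (p.2.span_oneAndCoords_ideal p.1)⟩
  simpa only [ideal_eq_iff] using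
    MultTable.existsUnique_isNormalized_isTableOf h2 hI.basis hI.basis_none

end Ideals

/-! ### Openness of the symmetric locus -/

section Openness

section Support

variable {A B M : Type*} [CommRing A] [CommRing B] [Algebra A B] [AddCommGroup M] [Module A M]

theorem mem_support_baseChange [Module.Finite A M] (q : PrimeSpectrum B) :
    q ∈ Module.support B (B ⊗[A] M) ↔
      PrimeSpectrum.comap (algebraMap A B) q ∈ Module.support A M := by
  rw [Module.mem_support_iff_nontrivial_residueField_tensorProduct,
    Module.mem_support_iff_nontrivial_residueField_tensorProduct]
  set p := PrimeSpectrum.comap (algebraMap A B) q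
  let k := p.asIdeal.ResidueField
  let l := q.asIdeal.ResidueField
  have comap_eq : p.asIdeal = q.asIdeal.comap (algebraMap A B) := rfl
  let _ : Algebra k l :=
    (Ideal.ResidueField.map p.asIdeal q.asIdeal (algebraMap A B) comap_eq).toAlgebra
  have : IsScalarTower A k l := IsScalarTower.of_algebraMap_eq fun x => by
    rw [RingHom.algebraMap_toAlgebra, Ideal.ResidueField.map_algebraMap,
      IsScalarTower.algebraMap_apply A B]
  rw [(TensorProduct.AlgebraTensorModule.cancelBaseChange A B l l M).nontrivial_congr,
    ← (TensorProduct.AlgebraTensorModule.cancelBaseChange A k l l M).nontrivial_congr]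
  exact Module.FaithfullyFlat.nontrivial_tensorProduct_iff_right k l

theorem subsingleton_baseChange_iff [Module.Finite A M] :
    Subsingleton (B ⊗[A] M) ↔
      Set.range (PrimeSpectrum.comap (algebraMap A B)) ⊆ (Module.support A M)ᶜ := by
  rw [← Module.support_eq_empty_iff (R := B), Set.eq_empty_iff_forall_notMem, Set.range_subset_iff]
  exact forall_congr' fun q => not_congr (mem_support_baseChange q)

theorem subsingleton_baseChange_quotient_iff (N : Submodule A M) :
    Subsingleton (B ⊗[A] (M ⧸ N)) ↔ N.baseChange B = ⊤ := by
  have mem_iff (x : B ⊗[A] M) : x ∈ N.baseChange B ↔ N.mkQ.lTensor B x = 0 :=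
    (lTensor_exact B (LinearMap.exact_subtype_mkQ N) N.mkQ_surjective x).symm
  rw [subsingleton_iff_forall_eq 0, (LinearMap.lTensor_surjective B N.mkQ_surjective).forall,
    Submodule.eq_top_iff']
  exact forall_congr' fun x => (mem_iff x).symm

end Support

variable {d : ℕ} {A : Type*} [CommRing A] {I : Ideal (MvPolynomial (Fin d) A)}

theorem HasColength.isSymmetric_iff (h : HasColength (d + 1) I) :
    IsSymmetric I ↔ Submodule.span A (Set.range (oneAndCoords I)) = ⊤ := by
  refine ⟨IsSymmetric.span_eq_top, fun hs => ⟨?_, hs⟩⟩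
  have := h.finite
  have := h.projective
  have surjective : Function.Surjective (Fintype.linearCombination A (oneAndCoords I)) := by
    rw [← LinearMap.range_eq_top, Fintype.range_linearCombination, hs]
  -- A surjection between finite projective modules of the same rank is bijective.
  refine linearIndependent_iff_injective_fintypeLinearCombination.mpr
    (Module.bijective_of_surjective_of_rankAtStalk_eq surjective fun m _ => ?_).injective
  have := PrimeSpectrum.nontrivial ⟨m, inferInstance⟩
  rw [h.rank, Module.rankAtStalk_eq_finrank_of_free]
  simp

variable {B : Type*} [CommRing B] [Algebra A B]

theorem quotientBaseChange_oneAndCoords (o : Option (Fin d)) :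
    quotientBaseChange (B := B) I (1 ⊗ₜ oneAndCoords I o) =
      oneAndCoords (I.map (MvPolynomial.map (algebraMap A B))) o := by
  rcases o with _ | i
  · exact map_one (quotientBaseChange (B := B) I)
  · rw [oneAndCoords, quotientBaseChange_one_tmul_mk, MvPolynomial.map_X, oneAndCoords]

theorem span_oneAndCoords_map_eq_top_iff :
    Submodule.span B (Set.range (oneAndCoords (I.map (MvPolynomial.map (algebraMap A B))))) = ⊤ ↔
      Subsingleton (B ⊗[A] ((MvPolynomial (Fin d) A ⧸ I) ⧸
        Submodule.span A (Set.range (oneAndCoords I)))) := by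
  let e := (quotientBaseChange (B := B) I).toLinearEquiv
  have e_comp : oneAndCoords (I.map (MvPolynomial.map (algebraMap A B))) =
      e ∘ TensorProduct.mk A B (MvPolynomial (Fin d) A ⧸ I) 1 ∘ oneAndCoords I :=
    funext fun o => (quotientBaseChange_oneAndCoords o).symm
  rw [subsingleton_baseChange_quotient_iff, Submodule.baseChange_span, ← Set.range_comp, e_comp,
    Set.range_comp, ← LinearEquiv.coe_coe, ← Submodule.map_span,
    Submodule.map_eq_top_iff]

theorem isOpenSubfunctor_symFunctor (d : ℕ) : IsOpenSubfunctor (symFunctor d) := by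
  rintro A ⟨I, hI⟩
  have := hI.finite
  -- The complement of the support of the cokernel of `1, x_1, …, x_d`.
  let K := (MvPolynomial (Fin d) A ⧸ I) ⧸ Submodule.span A (Set.range (oneAndCoords I))
  refine ⟨⟨(Module.support A K)ᶜ, Module.isClosed_support.isOpen_compl⟩, fun B f => ?_⟩
  algebraize [f.hom.toRingHom]
  exact (hI.map _).isSymmetric_iff.trans
    (span_oneAndCoords_map_eq_top_iff.trans subsingleton_baseChange_iff)

end Openness

/-! ### The universal multiplication table -/

section Universal

open MvPolynomial

section UnivCoeff

variable (d : ℕ)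

/-- The index set of the linear coefficients of a normalized multiplication table, that is, of
the coefficients of `x_k` in `x_i x_j` without those with `i = j = k`. -/
abbrev CoeffIndex : Type := Σ k : Fin d, {s : Sym2 (Fin d) // s ≠ s(k, k)}

theorem card_coeffIndex : Fintype.card (CoeffIndex d) = d * ((d + 1).choose 2 - 1) := by
  rw [Fintype.card_sigma]
  simp [Fintype.card_subtype_compl, Sym2.card]

/-- The enumeration of the linear coefficients by the variables of the polynomial ring. -/
def coeffEquiv : CoeffIndex d ≃ Fin (d * ((d + 1).choose 2 - 1)) :=
  Fintype.equivFinOfCardEq (card_coeffIndex d)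

/-- The linear coefficients of the universal normalized multiplication table. -/
def univCoeff (i j k : Fin d) : polyRing d :=
  if h : s(i, j) = s(k, k) then 0 else X (coeffEquiv d ⟨k, s(i, j), h⟩)

/-- The ideal `I_d` of the relations between the linear coefficients of a normalized
multiplication table. -/
def quadIdeal : Ideal (polyRing d) := Ideal.span (quadrics (univCoeff d))

variable {d}

theorem univCoeff_comm (i j k : Fin d) : univCoeff d i j k = univCoeff d j i k := by
  simp only [univCoeff, Sym2.eq_swap (a := i) (b := j)]

theorem univCoeff_self (k : Fin d) : univCoeff d k k k = 0 := by
  simp [univCoeff]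

theorem existsUnique_algHom_univCoeff {A : Type*} [CommSemiring A] [Algebra ℂ A]
    {c : Fin d → Fin d → Fin d → A} (hc : ∀ i j k, c i j k = c j i k) (h0 : ∀ k, c k k k = 0) :
    ∃! g : polyRing d →ₐ[ℂ] A, ∀ i j k, g (univCoeff d i j k) = c i j k := by
  let v : CoeffIndex d → A := fun n => Sym2.lift ⟨fun i j => c i j n.1, fun i j => hc i j n.1⟩ n.2.1
  refine ⟨aeval fun n => v ((coeffEquiv d).symm n), fun i j k => ?_, fun g hg => ?_⟩
  · by_cases h : s(i, j) = s(k, k)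
    · obtain ⟨rfl, rfl⟩ : i = k ∧ j = k := by simpa using h
      rw [univCoeff_self, map_zero, h0]
    · rw [univCoeff, dif_neg h, aeval_X, Equiv.symm_apply_apply]
      rfl
  · refine algHom_ext fun n => ?_
    obtain ⟨⟨k, s, hs⟩, rfl⟩ := (coeffEquiv d).surjective n
    rw [aeval_X, Equiv.symm_apply_apply]
    induction s with
    | _ i j =>
      have := hg i j k
      rwa [univCoeff, dif_neg hs] at this

theorem univCoeff_isHomogeneous (i j k : Fin d) : (univCoeff d i j k).IsHomogeneous 1 := by
  unfold univCoeff
  split_ifs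
  · exact isHomogeneous_zero _ _ _
  · exact isHomogeneous_X _ _

end UnivCoeff

section Quadrics

theorem assocDefect_isHomogeneous {ι σ R : Type*} [Fintype ι] [CommRing R]
    {c : ι → ι → ι → MvPolynomial σ R} {r : ℕ} (hc : ∀ i j k, (c i j k).IsHomogeneous r)
    (i j k m : ι) : (assocDefect c i j k m).IsHomogeneous (r + r) :=
  (IsHomogeneous.sum _ _ _ fun l _ => (hc j k l).mul (hc i l m)).sub
    (IsHomogeneous.sum _ _ _ fun l _ => (hc i j l).mul (hc k l m))

theorem isHomogeneous_of_mem_quadrics {ι σ R : Type*} [Fintype ι] [CommRing R]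
    {c : ι → ι → ι → MvPolynomial σ R} {r : ℕ} (hc : ∀ i j k, (c i j k).IsHomogeneous r)
    {q : MvPolynomial σ R} (hq : q ∈ quadrics c) : q.IsHomogeneous (r + r) := by
  rcases hq with ⟨i, j, k, m, -, -, rfl⟩ | ⟨i, j, k, i', -, -, rfl⟩
  · exact assocDefect_isHomogeneous hc i j k m
  · exact (assocDefect_isHomogeneous hc i j k i).sub (assocDefect_isHomogeneous hc i' k j i')

theorem homogeneousComponent_mem_span {σ R : Type*} [CommSemiring R] {S : Set (MvPolynomial σ R)}
    {r : ℕ} (hS : ∀ q ∈ S, q.IsHomogeneous r) {p : MvPolynomial σ R} (hp : p ∈ Ideal.span S)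
    (n : ℕ) : homogeneousComponent n p ∈ Ideal.span S := by
  let _ := gradedAlgebra (σ := σ) (R := R)
  have h := Ideal.homogeneous_span (homogeneousSubmodule σ R) S
    fun q hq => ⟨r, (mem_homogeneousSubmodule r q).mpr (hS q hq)⟩
  rw [← decomposition.decompose'_apply]
  exact h n hp

theorem eq_zero_of_mem_quadrics_fin_two {A : Type*} [CommRing A] {c : Fin 2 → Fin 2 → Fin 2 → A}
    (hc : ∀ i j k, c i j k = c j i k) {q : A} (hq : q ∈ quadrics c) : q = 0 := by
  rcases hq with ⟨i, j, k, m, hi, hk, rfl⟩ | ⟨i, j, k, i', hi, hi', rfl⟩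
  · obtain rfl : i = k := by omega
    rw [assocDefect]
    simp only [hc i j, sub_self]
  · obtain ⟨rfl, rfl⟩ | ⟨rfl, rfl⟩ : k = j ∧ i = i' ∨ i = j ∧ k = i' := by omega
    · exact sub_self _
    · obtain ⟨rfl, rfl⟩ | ⟨rfl, rfl⟩ : i = 0 ∧ k = 1 ∨ i = 1 ∧ k = 0 := by omega
      all_goals
        simp only [assocDefect, Fin.sum_univ_two, hc 1 0]
        ring

theorem quadIdeal_two : quadIdeal 2 = ⊥ :=
  Ideal.span_eq_bot.mpr fun _ => eq_zero_of_mem_quadrics_fin_two univCoeff_comm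

end Quadrics

section UnivTable

variable (d : ℕ)

/-- The coordinate ring of `ℂ^d × Spec (R_d / I_d)`. -/
abbrev univRing : Type := MvPolynomial (Fin d) ℂ ⊗[ℂ] (polyRing d ⧸ quadIdeal d)

variable {d}

/-- The universal translation, given by the coordinates of `ℂ^d`. -/
def univTranslation (i : Fin d) : univRing d :=
  Algebra.TensorProduct.includeLeft (S := ℂ) (X i : MvPolynomial (Fin d) ℂ)

variable [Nontrivial (Fin d)]

/-- The universal normalized multiplication table, with coefficients in `R_d / I_d`. -/
def quotTable : MultTable (Fin d) (polyRing d ⧸ quadIdeal d) :=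
  .ofCoeff (fun i j k => Ideal.Quotient.mk _ (univCoeff d i j k))
    (fun i j k => by rw [univCoeff_comm]) fun q hq => by
      rw [quadrics_map] at hq
      obtain ⟨p, hp, rfl⟩ := hq
      exact Ideal.Quotient.eq_zero_iff_mem.mpr (Ideal.subset_span hp)

theorem quotTable_coeff (i j k : Fin d) :
    quotTable.coeff i j k = Ideal.Quotient.mk (quadIdeal d) (univCoeff d i j k) := rfl

theorem quotTable_isNormalized : (quotTable (d := d)).IsNormalized := fun k => by
  rw [quotTable_coeff, univCoeff_self, map_zero]

theorem existsUnique_quotTable_map {A : Type*} [CommRing A] [Algebra ℂ A]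
    {T : MultTable (Fin d) A} (hT : T.IsNormalized) :
    ∃! f : (polyRing d ⧸ quadIdeal d) →ₐ[ℂ] A, quotTable.map f.toRingHom = T := by
  obtain ⟨g, hg, g_unique⟩ := existsUnique_algHom_univCoeff T.coeff_comm hT
  have image_quadrics : g.toRingHom '' quadrics (univCoeff d) = quadrics T.coeff := by
    rw [← quadrics_map]
    exact congrArg quadrics (funext fun i => funext fun j => funext fun k => hg i j k)
  have quadIdeal_le : quadIdeal d ≤ RingHom.ker g := Ideal.span_le.mpr fun q hq =>
    T.eq_zero_of_mem_quadrics (image_quadrics ▸ Set.mem_image_of_mem _ hq)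
  refine ⟨Ideal.Quotient.liftₐ _ g fun _ hp => quadIdeal_le hp, MultTable.ext_of_coeff ?_,
    fun f hf => Ideal.Quotient.algHom_ext _ ?_⟩
  · funext i j k
    exact hg i j k
  · refine (g_unique (f.comp (Ideal.Quotient.mkₐ ℂ _)) fun i j k => ?_).trans ?_
    · rw [← hf]
      rfl
    · exact AlgHom.ext fun _ => rfl

/-- The universal normalized multiplication table over the coordinate ring of
`ℂ^d × Spec (R_d / I_d)`. -/
def univTable : MultTable (Fin d) (univRing d) :=
  quotTable.map (Algebra.TensorProduct.includeRight : _ →ₐ[ℂ] univRing d).toRingHom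

theorem existsUnique_univTable_map {A : Type*} [CommRing A] [Algebra ℂ A] (t : Fin d → A)
    {T : MultTable (Fin d) A} (hT : T.IsNormalized) : ∃! f : univRing d →ₐ[ℂ] A,
      (∀ i, f (univTranslation i) = t i) ∧ univTable.map f.toRingHom = T := by
  obtain ⟨g, hg, g_unique⟩ := existsUnique_quotTable_map hT
  refine ⟨Algebra.TensorProduct.productMap (aeval t) g, ⟨fun i => ?_, ?_⟩, fun f hf => ?_⟩
  · simp [univTranslation]
  · rw [← hg]
    refine MultTable.ext_of_coeff ?_
    funext i j k
    exact Algebra.TensorProduct.productMap_right_apply _ _ _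
  · refine Algebra.TensorProduct.ext (algHom_ext fun i => ?_) ?_
    · rw [Algebra.TensorProduct.productMap_left]
      exact (hf.1 i).trans (aeval_X t i).symm
    · exact (g_unique _ hf.2).trans (Algebra.TensorProduct.productMap_right _ _).symm

end UnivTable

section UnivIdeal

variable {d : ℕ} [Nontrivial (Fin d)]

/-- The universal symmetric ideal. -/
def univIdeal : (symFunctor d).toFunctor.obj (CommAlgCat.of ℂ (univRing d)) :=
  have h := univTable.isSymmetric_ideal univTranslation
  ⟨⟨univTable.ideal univTranslation, h.hasColength⟩, h⟩

theorem coe_map_univIdeal {A : CommAlgCat.{0} ℂ} (f : CommAlgCat.of ℂ (univRing d) ⟶ A) :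
    ((symFunctor d).toFunctor.map f univIdeal).1.1 =
      (univTable.map f.hom.toRingHom).ideal fun i => f.hom (univTranslation i) :=
  MultTable.ideal_map _ _ _

theorem map_univIdeal_bijective (A : CommAlgCat.{0} ℂ) :
    Function.Bijective fun f : CommAlgCat.of ℂ (univRing d) ⟶ A =>
      (symFunctor d).toFunctor.map f univIdeal := by
  have isUnit_two : IsUnit (2 : A) := by
    rw [← map_ofNat (algebraMap ℂ A) 2]
    exact (IsUnit.mk0 2 two_ne_zero).map _
  refine (Function.bijective_iff_existsUnique _).mpr fun ⟨⟨I, _⟩, hI⟩ => ?_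
  obtain ⟨⟨t, T⟩, ⟨hT, rfl⟩, pair_unique⟩ := IsSymmetric.existsUnique_ideal_eq hI isUnit_two
  obtain ⟨f, ⟨hft, hfT⟩, f_unique⟩ := existsUnique_univTable_map t hT
  refine ⟨CommAlgCat.ofHom f, Subtype.ext (Subtype.ext ?_), fun g hg => ?_⟩
  · rw [coe_map_univIdeal]
    simp only [CommAlgCat.hom_ofHom, hft, hfT]
  · have ideal_eq := (coe_map_univIdeal g).symm.trans (congrArg (fun J => J.1.1) hg)
    have pair_eq := pair_unique (fun i => g.hom (univTranslation i), univTable.map g.hom.toRingHom)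
      ⟨(quotTable_isNormalized.map _).map _, ideal_eq⟩
    have ⟨translation_eq, table_eq⟩ := Prod.ext_iff.mp pair_eq
    exact CommAlgCat.hom_ext (f_unique g.hom ⟨congrFun translation_eq, table_eq⟩)

end UnivIdeal

end Universal

/-! ### Schemes and their functors of points -/

section Schemes

/-- `Spec A` as a scheme over `ℂ`, for a `ℂ`-algebra `A`. -/
abbrev specAlg (A : CommAlgCat.{0} ℂ) : SchC := (algSpec (CommRingCat.of ℂ)).obj (.op A)

/-- The morphism of spectra induced by a homomorphism of `ℂ`-algebras. -/
abbrev specAlgMap {A B : CommAlgCat.{0} ℂ} (φ : A ⟶ B) : specAlg B ⟶ specAlg A :=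
  (algSpec (CommRingCat.of ℂ)).map φ.op

theorem exists_specAlgMap_eq {A B : CommAlgCat.{0} ℂ} (g : specAlg B ⟶ specAlg A) :
    ∃ φ : A ⟶ B, specAlgMap φ = g :=
  ⟨(algSpec.fullyFaithful.preimage g).unop, algSpec.fullyFaithful.map_preimage g⟩

theorem exists_nonempty_specAlg_iso {Z : SchC} (hZ : IsAffine Z.left) :
    ∃ A : CommAlgCat.{0} ℂ, Nonempty (specAlg A ≅ Z) := by
  obtain ⟨A, ⟨e⟩⟩ := essImage_algSpec.mpr hZ
  exact ⟨A.unop, ⟨e⟩⟩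

variable {X Y : SchC}

section BijectiveOnPoints

variable {f : X ⟶ Y}

theorem comp_bijective_of_isAffine
    (hf : ∀ A, Function.Bijective fun g : specAlg A ⟶ X => g ≫ f) {Z : SchC}
    (hZ : IsAffine Z.left) : Function.Bijective fun g : Z ⟶ X => g ≫ f := by
  obtain ⟨A, ⟨e⟩⟩ := exists_nonempty_specAlg_iso hZ
  refine ⟨fun a b hab => ?_, fun b => ?_⟩
  · rw [← cancel_epi e.hom]
    exact (hf A).1 (by simpa using hab)
  · obtain ⟨a, ha⟩ := (hf A).2 (e.hom ≫ b)
    exact ⟨e.inv ≫ a, by simpa using congrArg (fun g => e.inv ≫ g) ha⟩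

theorem mono_left_of_comp_bijective
    (hf : ∀ A, Function.Bijective fun g : specAlg A ⟶ X => g ≫ f) : Mono f.left := by
  refine ⟨fun {T} a b hab => ?_⟩
  have over_eq : a ≫ X.hom = b ≫ X.hom := by
    rw [← Over.w f, reassoc_of% hab]
  refine Scheme.Cover.hom_ext T.affineCover _ _ fun i => ?_
  let Z : SchC := Over.mk (T.affineCover.f i ≫ a ≫ X.hom)
  let a' : Z ⟶ X := Over.homMk (T.affineCover.f i ≫ a) (by simp [Z])
  let b' : Z ⟶ X := Over.homMk (T.affineCover.f i ≫ b) (by simp [Z, over_eq])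
  have isAffine_Z : IsAffine Z.left := inferInstanceAs (IsAffine (T.affineCover.X i))
  have : a' = b' := by
    refine (comp_bijective_of_isAffine hf isAffine_Z).1 ?_
    ext : 1
    simp [a', b', hab]
  exact congrArg (fun g => g.left) this

theorem isIso_of_comp_bijective
    (hf : ∀ A, Function.Bijective fun g : specAlg A ⟶ X => g ≫ f) : IsIso f := by
  have := mono_left_of_comp_bijective hf
  -- Locally on the target, `f` is a monomorphism with a section.
  have : IsIso ((Over.forget _).map f) := by
    refine (IsZariskiLocalAtTarget.iff_of_openCover (P := MorphismProperty.isomorphisms Scheme)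
      Y.left.affineCover).mpr fun i => ?_
    let c := Y.left.affineCover.f i
    let Z : SchC := Over.mk (c ≫ Y.hom)
    have isAffine_Z : IsAffine Z.left := inferInstanceAs (IsAffine (Y.left.affineCover.X i))
    obtain ⟨s, hs⟩ := (comp_bijective_of_isAffine hf isAffine_Z).2 (Over.homMk c rfl : Z ⟶ Y)
    have s_comp : s.left ≫ f.left = c := congrArg (fun g => g.left) hs
    have : IsSplitEpi (pullback.snd f.left c) :=
      ⟨⟨pullback.lift s.left (𝟙 _) (by rw [s_comp, Category.id_comp]), pullback.lift_snd _ _ _⟩⟩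
    exact isIso_of_mono_of_isSplitEpi (pullback.snd f.left c)
  exact isIso_of_reflects_iso f (Over.forget _)

end BijectiveOnPoints

theorem nonempty_specAlg_iso {S : CommAlgCat.{0} ℂ}
    (α : functorOfPoints (specAlg S) ≅ functorOfPoints X) : Nonempty (specAlg S ≅ X) := by
  let f : specAlg S ⟶ X := α.hom.app S (𝟙 (specAlg S))
  have comp_eq (A : CommAlgCat.{0} ℂ) (g : specAlg A ⟶ specAlg S) : g ≫ f = α.hom.app A g := by
    obtain ⟨φ, rfl⟩ := exists_specAlgMap_eq g
    have := NatTrans.naturality_apply α.hom φ (𝟙 (specAlg S))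
    exact this.symm.trans (congrArg _ (Category.comp_id (specAlgMap φ)))
  have : IsIso f := isIso_of_comp_bijective fun A => by
    simp only [comp_eq]
    exact (α.app A).toEquiv.bijective
  exact ⟨asIso f⟩

theorem exists_specAlg_openImmersion (X : SchC) (x : X.left) :
    ∃ (A : CommAlgCat.{0} ℂ) (g : specAlg A ⟶ X), IsOpenImmersion g.left ∧
      x ∈ Set.range g.left := by
  let c := X.left.affineCover.f (X.left.affineCover.idx x)
  let Z : SchC := Over.mk (c ≫ X.hom)
  obtain ⟨A, ⟨e⟩⟩ := exists_nonempty_specAlg_iso (Z := Z)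
    (inferInstanceAs (IsAffine (X.left.affineCover.X _)))
  have : IsIso e.hom.left := inferInstanceAs (IsIso ((Over.forget _).map e.hom))
  refine ⟨A, e.hom ≫ Over.homMk c rfl, ?_, ?_⟩
  · exact inferInstanceAs (IsOpenImmersion (e.hom.left ≫ c))
  · obtain ⟨y, hy⟩ := X.left.affineCover.covers x
    obtain ⟨z, rfl⟩ := e.hom.left.surjective y
    exact ⟨z, hy⟩

section Residue

/-- The canonical point `Spec κ(x) → X` as a morphism. -/
def residueMap (X : SchC) (x : X.left) : specAlg (residueAlg X x) ⟶ X := residuePoint X x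

theorem exists_residueMap_comp (f : X ⟶ Y) (x : X.left) :
    ∃ φ : residueAlg Y (f.left x) ⟶ residueAlg X x,
      specAlgMap φ ≫ residueMap Y (f.left x) = residueMap X x ≫ f := by
  let r : (specAlg (residueAlg X x)).left ⟶ (specAlg (residueAlg Y (f.left x))).left :=
    Spec.map (f.left.residueFieldMap x)
  have r_comp : r ≫ Y.left.fromSpecResidueField (f.left x) =
      X.left.fromSpecResidueField x ≫ f.left :=
    Scheme.Hom.SpecMap_residueFieldMap_fromSpecResidueField f.left x
  have over_eq : r ≫ (specAlg (residueAlg Y (f.left x))).hom = (specAlg (residueAlg X x)).hom := by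
    rw [← Over.w (residueMap Y (f.left x)), ← Over.w (residueMap X x), ← Over.w f]
    exact (reassoc_of% r_comp) _
  obtain ⟨φ, hφ⟩ := exists_specAlgMap_eq (Over.homMk r over_eq)
  exact ⟨φ, hφ ▸ Over.OverMorphism.ext r_comp⟩

instance (X : SchC) (x : X.left) : Unique (PrimeSpectrum (residueAlg X x)) :=
  inferInstanceAs (Unique (PrimeSpectrum (X.left.residueField x)))

end Residue

section OpenLocus

variable {F : CommAlgCat.{0} ℂ ⥤ Type} {G : Subfunctor F} {H : SchC}

/-- The element of `F(A)` defined by an `A`-valued point of `H`. -/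
def evalPoint (e : functorOfPoints H ⟶ F) {A : CommAlgCat.{0} ℂ} (f : specAlg A ⟶ H) : F.obj A :=
  e.app A f

theorem evalPoint_comp (e : functorOfPoints H ⟶ F) {A B : CommAlgCat.{0} ℂ} (φ : A ⟶ B)
    (f : specAlg A ⟶ H) : evalPoint e (specAlgMap φ ≫ f) = F.map φ (evalPoint e f) :=
  NatTrans.naturality_apply e φ f

theorem evalPoint_bijective (e : functorOfPoints H ≅ F) (A : CommAlgCat.{0} ℂ) :
    Function.Bijective (evalPoint e.hom : (specAlg A ⟶ H) → F.obj A) :=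
  (e.app A).toEquiv.bijective

/-- The locus of points of `H` whose canonical point lies in a subfunctor of the functor of points
of `H`. -/
def pointLocus (G : Subfunctor F) (e : functorOfPoints H ≅ F) : Set H.left :=
  {h | evalPoint e.hom (residueMap H h) ∈ G.obj (residueAlg H h)}

theorem evalPoint_residueMap_comp_mem_iff (hG : IsOpenSubfunctor G) (e : functorOfPoints H ≅ F)
    (f : X ⟶ H) (x : X.left) :
    evalPoint e.hom (residueMap X x ≫ f) ∈ G.obj (residueAlg X x) ↔ f.left x ∈ pointLocus G e := by
  obtain ⟨φ, hφ⟩ := exists_residueMap_comp f x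
  rw [← hφ, evalPoint_comp]
  set y := evalPoint e.hom (residueMap H (f.left x))
  refine ⟨fun h => ?_, fun h => G.map φ h⟩
  -- An open subset of the one-point space `Spec κ(f x)` which contains an image is everything.
  obtain ⟨U, hU⟩ := hG _ y
  have default_mem : default ∈ U := (hU _ φ).mp h ⟨default, Subsingleton.elim _ _⟩
  have := (hU _ (𝟙 _)).mpr fun p _ => Unique.eq_default p ▸ default_mem
  rwa [F.map_id] at this

theorem mem_iff_left_mem_pointLocus (hG : IsOpenSubfunctor G) (e : functorOfPoints H ≅ F)
    {A : CommAlgCat.{0} ℂ} (f : specAlg A ⟶ H) {U : TopologicalSpace.Opens (PrimeSpectrum A)}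
    (hU : ∀ (B : CommAlgCat.{0} ℂ) (φ : A ⟶ B), F.map φ (evalPoint e.hom f) ∈ G.obj B ↔
      Set.range (PrimeSpectrum.comap φ.hom.toRingHom) ⊆ U) (p : (specAlg A).left) :
    p ∈ (U : Set (PrimeSpectrum A)) ↔ f.left p ∈ pointLocus G e := by
  obtain ⟨φ, hφ⟩ := exists_specAlgMap_eq (residueMap (specAlg A) p)
  have range_comap : Set.range (PrimeSpectrum.comap φ.hom.toRingHom) = {p} := by
    have left_eq : (specAlgMap φ).left = (specAlg A).left.fromSpecResidueField p :=
      congrArg (fun g => g.left) hφ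
    have := Scheme.range_fromSpecResidueField p
    rwa [← left_eq] at this
  rw [← evalPoint_residueMap_comp_mem_iff hG e f p, ← hφ, evalPoint_comp, hU, range_comap]
  exact Set.singleton_subset_iff.symm

theorem isOpen_pointLocus (hG : IsOpenSubfunctor G) (e : functorOfPoints H ≅ F) :
    IsOpen (pointLocus G e) := by
  rw [isOpen_iff_forall_mem_open]
  intro h hh
  obtain ⟨A, g, _, p, rfl⟩ := exists_specAlg_openImmersion H h
  obtain ⟨U, hU⟩ := hG A (evalPoint e.hom g)
  have mem_iff := mem_iff_left_mem_pointLocus hG e g hU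
  exact ⟨g.left '' (U : Set (PrimeSpectrum A)),
    Set.image_subset_iff.mpr fun q hq => (mem_iff q).mp hq,
    g.left.isOpenEmbedding.isOpenMap _ U.isOpen, p, (mem_iff p).mpr hh, rfl⟩

theorem evalPoint_mem_iff_range_subset (hG : IsOpenSubfunctor G) (e : functorOfPoints H ≅ F)
    {A : CommAlgCat.{0} ℂ} (f : specAlg A ⟶ H) :
    evalPoint e.hom f ∈ G.obj A ↔ Set.range f.left ⊆ pointLocus G e := by
  obtain ⟨U, hU⟩ := hG A (evalPoint e.hom f)
  have := hU A (𝟙 A)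
  rw [F.map_id] at this
  refine this.trans ?_
  rw [Set.range_subset_iff, Set.range_subset_iff]
  exact forall_congr' fun p => mem_iff_left_mem_pointLocus hG e f hU p

/-- The inclusion of an open subscheme. -/
def openCι (X : SchC) (U : X.left.Opens) : openC X U ⟶ X := Over.homMk U.ι rfl

instance (X : SchC) (U : X.left.Opens) : Mono (openCι X U) :=
  have : Mono ((Over.forget _).map (openCι X U)) := inferInstanceAs (Mono U.ι)
  (Over.forget _).mono_of_mono_map this

theorem exists_comp_openCι_iff {U : Y.left.Opens} {f : X ⟶ Y} :
    (∃ g : X ⟶ openC Y U, g ≫ openCι Y U = f) ↔ Set.range f.left ⊆ U := by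
  constructor
  · rintro ⟨g, rfl⟩ _ ⟨x, rfl⟩
    exact (g.left x).2
  · intro h
    let l : X.left ⟶ U := IsOpenImmersion.lift U.ι f.left (by rwa [Scheme.Opens.range_ι])
    have l_comp : l ≫ U.ι = f.left := IsOpenImmersion.lift_fac _ _ _
    have over_eq : l ≫ (openC Y U).hom = X.hom := by
      rw [← Over.w f, ← l_comp, Category.assoc]
      rfl
    exact ⟨Over.homMk l over_eq, Over.OverMorphism.ext l_comp⟩

/-- The open subscheme of `H` on the locus of an open subfunctor of its functor of points represents
this subfunctor. -/
def openCPointLocusIso (hG : IsOpenSubfunctor G) (e : functorOfPoints H ≅ F) :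
    functorOfPoints (openC H ⟨pointLocus G e, isOpen_pointLocus hG e⟩) ≅ G.toFunctor :=
  let U : H.left.Opens := ⟨pointLocus G e, isOpen_pointLocus hG e⟩
  have mem_iff {A : CommAlgCat.{0} ℂ} (f : specAlg A ⟶ H) :
      evalPoint e.hom f ∈ G.obj A ↔ ∃ g, g ≫ openCι H U = f :=
    (evalPoint_mem_iff_range_subset hG e f).trans (exists_comp_openCι_iff (U := U)).symm
  let toG (A : CommAlgCat.{0} ℂ) (g : specAlg A ⟶ openC H U) : G.toFunctor.obj A :=
    ⟨evalPoint e.hom (g ≫ openCι H U), (mem_iff _).mpr ⟨g, rfl⟩⟩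
  have toG_bijective (A : CommAlgCat.{0} ℂ) : Function.Bijective (toG A) := by
    refine ⟨fun a b hab => ?_, fun ⟨y, hy⟩ => ?_⟩
    · exact (cancel_mono (openCι H U)).mp ((evalPoint_bijective e A).1 (congrArg Subtype.val hab))
    · obtain ⟨f, rfl⟩ := (evalPoint_bijective e A).2 y
      obtain ⟨g, rfl⟩ := (mem_iff f).mp hy
      exact ⟨g, rfl⟩
  NatIso.ofComponents (fun A => (Equiv.ofBijective _ (toG_bijective A)).toIso) fun φ => by
    ext g
    exact Subtype.ext ((congrArg _ (Category.assoc _ _ _)).trans (evalPoint_comp e.hom φ _))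

end OpenLocus

section Product

/-- Affine space is the spectrum of a polynomial ring. -/
def affineSpaceCIso (d : ℕ) : affineSpaceC d ≅ specC (MvPolynomial (Fin d) ℂ) :=
  Over.isoMk (AffineSpace.SpecIso (Fin d) (CommRingCat.of ℂ))
    ((Iso.inv_comp_eq _).mp (AffineSpace.SpecIso_inv_over (CommRingCat.of ℂ))).symm

/-- The functoriality of the product in its first factor, on isomorphisms. -/
def prodCCongrLeft {X X' : SchC} (e : X ≅ X') (Y : SchC) : prodC X Y ≅ prodC X' Y :=
  let i : X.left ≅ X'.left := (Over.forget _).mapIso e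
  have i_hom : X.hom = i.hom ≫ X'.hom := (Over.w e.hom).symm
  let p : pullback X.hom Y.hom ≅ pullback X'.hom Y.hom :=
    asIso (pullback.map X.hom Y.hom X'.hom Y.hom i.hom (𝟙 Y.left) (𝟙 _)
      ((Category.comp_id _).trans i_hom) ((Category.comp_id _).trans (Category.id_comp _).symm))
  have p_fst : p.hom ≫ pullback.fst _ _ = pullback.fst _ _ ≫ i.hom := pullback.lift_fst _ _ _
  Over.isoMk p (by
    change p.hom ≫ pullback.fst _ _ ≫ X'.hom = pullback.fst _ _ ≫ X.hom
    rw [reassoc_of% p_fst, i_hom])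

/-- The product of affine schemes is the spectrum of the tensor product. -/
def prodCSpecIso (A B : Type) [CommRing A] [Algebra ℂ A] [CommRing B] [Algebra ℂ B] :
    prodC (specC A) (specC B) ≅ specC (A ⊗[ℂ] B) :=
  Over.isoMk (pullbackSpecIso ℂ A B) (pullbackSpecIso_hom_base ℂ A B)

end Product

/-- The functor represented by the algebra `S` is the functor of points of `Spec S`. -/
def coyonedaIsoFunctorOfPoints (S : CommAlgCat.{0} ℂ) :
    coyoneda.obj (.op S) ≅ functorOfPoints (specAlg S) :=
  let homEquiv (A : CommAlgCat.{0} ℂ) : (S ⟶ A) ≃ (specAlg A ⟶ specAlg S) :=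
    Quiver.Hom.opEquiv.trans (algSpec.fullyFaithful (R := CommRingCat.of ℂ)).homEquiv
  NatIso.ofComponents (fun A => (homEquiv A).toIso) fun φ => by
    ext ψ
    exact (algSpec (CommRingCat.of ℂ)).map_comp φ.op ψ.op

section SymFunctor

variable {d : ℕ} [Nontrivial (Fin d)]

/-- The spectrum of the universal ring represents the functor of symmetric ideals. -/
def specUnivRingIso :
    functorOfPoints (specAlg (CommAlgCat.of ℂ (univRing d))) ≅ (symFunctor d).toFunctor :=
  have : IsIso (coyonedaEquiv.symm (univIdeal (d := d))) :=
    (NatTrans.isIso_iff_isIso_app _).mpr fun A =>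
      (isIso_iff_bijective _).mpr (map_univIdeal_bijective A)
  (coyonedaIsoFunctorOfPoints _).symm ≪≫ asIso (coyonedaEquiv.symm univIdeal)

end SymFunctor

/-- The scheme `ℂ^d × Spec (R_d / I_d)` is the spectrum of the universal ring. -/
def prodCIsoSpecUnivRing (d : ℕ) :
    prodC (affineSpaceC d) (specC (polyRing d ⧸ quadIdeal d)) ≅
      specAlg (CommAlgCat.of ℂ (univRing d)) :=
  prodCCongrLeft (affineSpaceCIso d) _ ≪≫ prodCSpecIso _ _

end Schemes

end HilbertPoints

end

theorem mainTheorem5 (d : ℕ) (hd : 2 ≤ d) :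
    ∃ I : Ideal (HilbertPoints.polyRing d),
      -- `I` is a homogeneous ideal
      (∀ p ∈ I, ∀ n : ℕ, MvPolynomial.homogeneousComponent n p ∈ I) ∧
      -- `I` is generated by quadratic forms
      (∃ S : Set (HilbertPoints.polyRing d), (∀ q ∈ S, q.IsHomogeneous 2) ∧ I = Ideal.span S) ∧
      (d = 2 → I = ⊥) ∧
      -- `V_d` as an open subfunctor of the Hilbert functor
      (HilbertPoints.IsOpenSubfunctor (HilbertPoints.symFunctor d) ∧
        Nonempty ((HilbertPoints.symFunctor d).toFunctor ≅
          HilbertPoints.functorOfPoints (HilbertPoints.prodC (HilbertPoints.affineSpaceC d)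
            (HilbertPoints.specC (HilbertPoints.polyRing d ⧸ I))))) ∧
      -- `V_d` as an open subscheme of the Hilbert scheme
      (∀ (H : HilbertPoints.SchC) (e : HilbertPoints.HilbertSchemeStructure d (d + 1) H),
        ∃ hU : IsOpen (HilbertPoints.symLocus e),
          Nonempty (HilbertPoints.openC H ⟨HilbertPoints.symLocus e, hU⟩ ≅
            HilbertPoints.prodC (HilbertPoints.affineSpaceC d)
              (HilbertPoints.specC (HilbertPoints.polyRing d ⧸ I)))) := by
  have : Nontrivial (Fin d) := Fin.nontrivial_iff_two_le.mpr hd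
  have isOpen_symFunctor := HilbertPoints.isOpenSubfunctor_symFunctor d
  have quadrics_isHomogeneous (q : HilbertPoints.polyRing d)
      (hq : q ∈ HilbertPoints.quadrics (HilbertPoints.univCoeff d)) : q.IsHomogeneous 2 :=
    HilbertPoints.isHomogeneous_of_mem_quadrics HilbertPoints.univCoeff_isHomogeneous hq
  let prodIso := HilbertPoints.prodCIsoSpecUnivRing d
  refine ⟨HilbertPoints.quadIdeal d,
    fun _ hp => HilbertPoints.homogeneousComponent_mem_span quadrics_isHomogeneous hp,
    ⟨_, quadrics_isHomogeneous, rfl⟩, ?_, ⟨isOpen_symFunctor, ⟨?_⟩⟩, fun H e => ?_⟩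
  · rintro rfl
    exact HilbertPoints.quadIdeal_two
  · exact HilbertPoints.specUnivRingIso.symm ≪≫
      Functor.isoWhiskerLeft _ (yoneda.mapIso prodIso.symm)
  · obtain ⟨i⟩ := HilbertPoints.nonempty_specAlg_iso
      (HilbertPoints.specUnivRingIso ≪≫ (HilbertPoints.openCPointLocusIso isOpen_symFunctor e).symm)
    exact ⟨HilbertPoints.isOpen_pointLocus isOpen_symFunctor e, ⟨i.symm ≪≫ prodIso.symm⟩⟩
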